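/- All vector spaces are real and all operators are linear. Let $E$ and $F$ be Banach lattices, with norm duals $E'$ and $F'$ (again Banach lattices, ordered by $f\le g$ iff $f(x)\le g(x)$ for all $x\ge 0$). Definitions. A sequence $(x_n)$ in a vector lattice is disjoint if $|x_m|\wedge|x_n|=0$ for $m\ne n$. A Banach lattice $G$ is a KB-space if every norm bounded increasing sequence in $G_+$ is norm convergent; it has order continuous norm if $\|x_\alpha\|\to 0$ for every net $x_\alpha\downarrow 0$ in $G$. $F$ has property (d) if for every disjoint weak$^*$ null sequence $(f_n)$ in $F'$ the sequence $(|f_n|)$ is weak$^*$ null. A bounded set $L\subseteq F$ is an LW-set if every disjoint sequence in its solid hull $\{y : |y|\le |x| \text{ for some } x\in L\}$ is norm null. A continuous operator $T:E\to F$ is almost L-weakly compact (a-LW) if it maps relatively weakly compact subsets of $E$ onto LW-subsets of $F$; it is almost Grothendieck (a-G) if its adjoint $T'$ maps disjoint weak$^*$ null sequences of $F'$ to weakly null sequences of $E'$. An operator is regularly a-LW (respectively regularly a-G) if it is a difference of two positive a-LW (respectively positive a-G) operators from $E$ to $F$. Theorem. (1) Suppose that $E'$ is a KB-space and $F$ has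 property (d). Then every regularly a-LW operator from $E$ to $F$ is regularly a-G. Moreover, for every positive a-LW operator $T:E\to F$ and every disjoint weak$^*$ null sequence $(f_n)$ in $F'$ one has $\|T'f_n\|\to 0$. (2) Suppose that $E'$ and $F$ both have order continuous norms. Then both conclusions of (1) hold. -/

import Mathlib

open Filter Topology

/-! ### The Banach lattice structure of the norm dual

A real Banach lattice is given by the Mathlib classes `NormedAddCommGroup E`, `NormedSpace ℝ E`,
`CompleteSpace E`, `Lattice E`, `IsOrderedAddMonoid E`, `IsOrderedModule ℝ E`, `HasSolidNorm E`.
The norm dual carries the order `f ≤ g` iff `f x ≤ g x` for all `x ≥ 0`; we prove that this order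
makes the dual a Banach lattice. -/

namespace BanachLat

section Dual

variable {E : Type*} [NormedAddCommGroup E] [NormedSpace ℝ E] [Lattice E]
  [IsOrderedAddMonoid E]

/-- The dual order: `f ≤ g` iff `f x ≤ g x` for every positive `x`. -/
instance dualPartialOrder : PartialOrder (StrongDual ℝ E) where
  le f g := ∀ x : E, 0 ≤ x → f x ≤ g x
  le_refl f x _ := le_rfl
  le_trans f g h hfg hgh x hx := (hfg x hx).trans (hgh x hx)
  le_antisymm f g hfg hgf := by
    ext x
    have key : ∀ y : E, 0 ≤ y → f y = g y := fun y hy => le_antisymm (hfg y hy) (hgf y hy)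
    rw [← posPart_sub_negPart x, map_sub, map_sub, key _ (posPart_nonneg x),
      key _ (negPart_nonneg x)]

theorem dual_le_def {f g : StrongDual ℝ E} : f ≤ g ↔ ∀ x : E, 0 ≤ x → f x ≤ g x := Iff.rfl

instance dualIsOrderedAddMonoid : IsOrderedAddMonoid (StrongDual ℝ E) where
  add_le_add_left f g h k x hx := by
    simpa using h x hx

instance dualIsOrderedModule : IsOrderedModule ℝ (StrongDual ℝ E) where
  smul_le_smul_of_nonneg_left r hr f g h x hx := by
    simpa using mul_le_mul_of_nonneg_left (h x hx) hr
  smul_le_smul_of_nonneg_right f hf r s h x hx := by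
    have := hf x hx
    simpa using mul_le_mul_of_nonneg_right h this

variable [HasSolidNorm E]

/-- `supIcc f x = sup {f y : 0 ≤ y ≤ x}`: the value at `x ≥ 0` of the positive part of `f`. -/
noncomputable def supIcc (f : StrongDual ℝ E) (x : E) : ℝ := sSup (f '' Set.Icc 0 x)

theorem norm_le_of_mem_Icc {x y : E} (hy : y ∈ Set.Icc 0 x) : ‖y‖ ≤ ‖x‖ :=
  norm_le_norm_of_abs_le_abs (by
    rw [abs_of_nonneg hy.1, abs_of_nonneg (hy.1.trans hy.2)]; exact hy.2)

theorem le_opNorm_of_mem_Icc (f : StrongDual ℝ E) {x y : E} (hy : y ∈ Set.Icc 0 x) :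
    f y ≤ ‖f‖ * ‖x‖ :=
  (le_abs_self _).trans ((f.le_opNorm y).trans
    (mul_le_mul_of_nonneg_left (norm_le_of_mem_Icc hy) (norm_nonneg f)))

theorem bddAbove_image_Icc (f : StrongDual ℝ E) (x : E) : BddAbove (f '' Set.Icc 0 x) := by
  refine ⟨‖f‖ * ‖x‖, ?_⟩
  rintro _ ⟨y, hy, rfl⟩
  exact le_opNorm_of_mem_Icc f hy

theorem le_supIcc (f : StrongDual ℝ E) {x y : E} (hy : y ∈ Set.Icc 0 x) : f y ≤ supIcc f x :=
  le_csSup (bddAbove_image_Icc f x) ⟨y, hy, rfl⟩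

theorem supIcc_le (f : StrongDual ℝ E) {x : E} (hx : 0 ≤ x) {c : ℝ}
    (h : ∀ y ∈ Set.Icc 0 x, f y ≤ c) : supIcc f x ≤ c := by
  refine csSup_le ⟨_, 0, ⟨le_rfl, hx⟩, rfl⟩ ?_
  rintro _ ⟨y, hy, rfl⟩
  exact h y hy

theorem supIcc_nonneg (f : StrongDual ℝ E) {x : E} (hx : 0 ≤ x) : 0 ≤ supIcc f x := by
  simpa using le_supIcc f (x := x) (y := 0) ⟨le_rfl, hx⟩

theorem supIcc_add (f : StrongDual ℝ E) {x y : E} (hx : 0 ≤ x) (hy : 0 ≤ y) :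
    supIcc f (x + y) = supIcc f x + supIcc f y := by
  refine le_antisymm (supIcc_le f (add_nonneg hx hy) fun z hz => ?_) ?_
  · have h1 : z ⊓ x ∈ Set.Icc 0 x := ⟨le_inf hz.1 hx, inf_le_right⟩
    have h2 : z - z ⊓ x ∈ Set.Icc 0 y := by
      refine ⟨sub_nonneg.2 inf_le_left, ?_⟩
      rw [sub_le_iff_le_add, add_comm, inf_add]
      exact le_inf (le_add_of_nonneg_right hy) hz.2
    have := add_le_add (le_supIcc f h1) (le_supIcc f h2)
    rwa [map_sub, add_sub_cancel] at this
  · rw [← le_sub_iff_add_le]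
    refine supIcc_le f hx fun u hu => ?_
    rw [le_sub_comm]
    refine supIcc_le f hy fun v hv => ?_
    rw [le_sub_iff_add_le', ← map_add]
    exact le_supIcc f ⟨add_nonneg hu.1 hv.1, add_le_add hu.2 hv.2⟩

theorem supIcc_posPart_sub (f : StrongDual ℝ E) {x a b : E} (ha : 0 ≤ a) (hb : 0 ≤ b)
    (h : x = a - b) : supIcc f x⁺ - supIcc f x⁻ = supIcc f a - supIcc f b := by
  have e : x⁺ + b = a + x⁻ := by
    have := posPart_sub_negPart x
    rw [← sub_eq_sub_iff_add_eq_add, this, h]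
  have e' := congrArg (supIcc f) e
  rw [supIcc_add f (posPart_nonneg x) hb, supIcc_add f ha (negPart_nonneg x)] at e'
  linarith

/-- The positive part of a continuous functional, as an additive map. -/
noncomputable def posPartHom (f : StrongDual ℝ E) : E →+ ℝ where
  toFun x := supIcc f x⁺ - supIcc f x⁻
  map_zero' := by simp
  map_add' x y := by
    rw [supIcc_posPart_sub f (x := x + y) (add_nonneg (posPart_nonneg x) (posPart_nonneg y))
      (add_nonneg (negPart_nonneg x) (negPart_nonneg y))
      (by rw [add_sub_add_comm, posPart_sub_negPart, posPart_sub_negPart]),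
      supIcc_add f (posPart_nonneg x) (posPart_nonneg y),
      supIcc_add f (negPart_nonneg x) (negPart_nonneg y)]
    ring

theorem posPartHom_continuous (f : StrongDual ℝ E) : Continuous (posPartHom f) := by
  refine AddMonoidHomClass.continuous_of_bound (posPartHom f) ‖f‖ fun x => ?_
  have hb : ∀ z : E, 0 ≤ z → |z| ≤ |x| → supIcc f z ≤ ‖f‖ * ‖x‖ := fun z hz hzx =>
    (supIcc_le f hz fun y hy => le_opNorm_of_mem_Icc f hy).trans
      (mul_le_mul_of_nonneg_left (norm_le_norm_of_abs_le_abs hzx) (norm_nonneg f))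
  have h1 := hb x⁺ (posPart_nonneg x) (by
    rw [abs_of_nonneg (posPart_nonneg x), ← posPart_add_negPart x]
    exact le_add_of_nonneg_right (negPart_nonneg x))
  have h2 := hb x⁻ (negPart_nonneg x) (by
    rw [abs_of_nonneg (negPart_nonneg x), ← posPart_add_negPart x]
    exact le_add_of_nonneg_left (posPart_nonneg x))
  have h3 := supIcc_nonneg f (posPart_nonneg x)
  have h4 := supIcc_nonneg f (negPart_nonneg x)
  change |supIcc f x⁺ - supIcc f x⁻| ≤ _
  rw [abs_le]
  constructor <;> linarith

/-- The positive part `f⁺` of a continuous functional: `f⁺ x = sup {f y : 0 ≤ y ≤ x}`, `x ≥ 0`. -/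
noncomputable def dualPosPart (f : StrongDual ℝ E) : StrongDual ℝ E :=
  (posPartHom f).toRealLinearMap (posPartHom_continuous f)

theorem dualPosPart_apply (f : StrongDual ℝ E) {x : E} (hx : 0 ≤ x) :
    dualPosPart f x = supIcc f x := by
  change supIcc f x⁺ - supIcc f x⁻ = _
  rw [supIcc_posPart_sub f hx le_rfl (sub_zero x).symm]
  simp [supIcc]

theorem le_dualPosPart (f : StrongDual ℝ E) : f ≤ dualPosPart f := fun x hx => by
  rw [dualPosPart_apply f hx]
  exact le_supIcc f ⟨hx, le_rfl⟩

theorem dualPosPart_nonneg (f : StrongDual ℝ E) : 0 ≤ dualPosPart f := fun x hx => by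
  rw [dualPosPart_apply f hx]
  exact supIcc_nonneg f hx

theorem dualPosPart_le {f g : StrongDual ℝ E} (hf : f ≤ g) (hg : 0 ≤ g) :
    dualPosPart f ≤ g := fun x hx => by
  rw [dualPosPart_apply f hx]
  refine supIcc_le f hx fun y hy => (hf y hy.1).trans ?_
  have := hg (x - y) (sub_nonneg.2 hy.2)
  rw [map_sub] at this
  simpa using this

/-- The lattice operations of the dual: `f ⊔ g = g + (f - g)⁺` and `f ⊓ g = f - (f - g)⁺`. -/
noncomputable instance dualLattice : Lattice (StrongDual ℝ E) where
  __ := dualPartialOrder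
  sup f g := g + dualPosPart (f - g)
  inf f g := f - dualPosPart (f - g)
  le_sup_left f g := sub_le_iff_le_add'.1 (le_dualPosPart (f - g))
  le_sup_right f g := le_add_of_nonneg_right (dualPosPart_nonneg (f - g))
  sup_le f g h hf hg := by
    rw [← le_sub_iff_add_le']
    exact dualPosPart_le (sub_le_sub_right hf g) (sub_nonneg.2 hg)
  inf_le_left f g := sub_le_self f (dualPosPart_nonneg (f - g))
  inf_le_right f g := sub_le_comm.1 (le_dualPosPart (f - g))
  le_inf h f g hf hg := by
    rw [le_sub_comm]
    exact dualPosPart_le (sub_le_sub_left hg f) (sub_nonneg.2 hf)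

theorem dual_abs_apply_le (f : StrongDual ℝ E) {x : E} (hx : 0 ≤ x) :
    |f| x ≤ ‖f‖ * ‖x‖ := by
  change -f x + dualPosPart (f - -f) x ≤ _
  rw [dualPosPart_apply _ hx, neg_add_le_iff_le_add]
  refine supIcc_le _ hx fun y hy => ?_
  have h : |y + y - x| ≤ |x| := by
    rw [abs_of_nonneg hx]
    refine abs_le'.2 ⟨?_, ?_⟩
    · rw [sub_le_iff_le_add]
      exact add_le_add hy.2 hy.2
    · rw [neg_sub]
      exact sub_le_self x (add_nonneg hy.1 hy.1)
  have h1 : f (y + y - x) ≤ ‖f‖ * ‖x‖ := (le_abs_self _).trans ((f.le_opNorm _).trans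
    (mul_le_mul_of_nonneg_left (norm_le_norm_of_abs_le_abs h) (norm_nonneg f)))
  rw [map_sub, map_add] at h1
  simp only [sub_neg_eq_add, add_apply]
  linarith

theorem abs_apply_le_dual_abs (f : StrongDual ℝ E) (x : E) : |f x| ≤ |f| |x| := by
  have h : ∀ y : E, 0 ≤ y → |f y| ≤ |f| y := fun y hy =>
    abs_le'.2 ⟨le_abs_self f y hy, neg_le_abs f y hy⟩
  rw [← posPart_add_negPart x, map_add]
  conv_lhs => rw [← posPart_sub_negPart x, map_sub]
  exact (abs_sub _ _).trans (add_le_add (h _ (posPart_nonneg x)) (h _ (negPart_nonneg x)))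

instance dualHasSolidNorm : HasSolidNorm (StrongDual ℝ E) where
  solid f g h := by
    refine f.opNorm_le_bound (norm_nonneg g) fun x => ?_
    refine (abs_apply_le_dual_abs f x).trans ((h _ (abs_nonneg x)).trans ?_)
    simpa [norm_abs_eq_norm] using dual_abs_apply_le g (abs_nonneg x)

end Dual

/-! ### Notions for Banach lattices -/

section Lattice

/-- A sequence is disjoint if its terms are pairwise disjoint: `|x n| ⊓ |x m| = 0` for `n ≠ m`. -/
def DisjointSeq {E : Type*} [Lattice E] [AddCommGroup E] (x : ℕ → E) : Prop :=
  ∀ m n, m ≠ n → |x m| ⊓ |x n| = 0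

/-- A KB-space: every norm bounded increasing sequence of positive vectors is norm convergent. -/
def IsKBSpace (E : Type*) [NormedAddCommGroup E] [Lattice E] : Prop :=
  ∀ x : ℕ → E, (∀ n, 0 ≤ x n) → Monotone x → Bornology.IsBounded (Set.range x) →
    ∃ l : E, Tendsto x atTop (𝓝 l)

/-- Order continuous norm: `‖x i‖ → 0` for every net `x i ↓ 0`. (Index types in the universe of
`E` suffice, since the range of a decreasing net is a decreasing net indexed by a subset of `E`.) -/
def HasOrderContinuousNorm.{u} (E : Type u) [NormedAddCommGroup E] [Lattice E] : Prop :=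
  ∀ (ι : Type u) [Preorder ι] [IsDirectedOrder ι] [Nonempty ι] (x : ι → E),
    Antitone x → IsGLB (Set.range x) 0 → Tendsto (fun i => ‖x i‖) atTop (𝓝 0)

/-- A sequence `f` in the dual is weak* null. -/
def WeakStarNull {E : Type*} [NormedAddCommGroup E] [NormedSpace ℝ E]
    (f : ℕ → StrongDual ℝ E) : Prop :=
  Tendsto (fun n => StrongDual.toWeakDual (f n)) atTop (𝓝 0)

/-- A sequence is weakly null. -/
def WeaklyNull {X : Type*} [NormedAddCommGroup X] [NormedSpace ℝ X] (x : ℕ → X) : Prop :=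
  Tendsto (fun n => toWeakSpace ℝ X (x n)) atTop (𝓝 0)

/-- A set is relatively weakly compact if its closure in the weak topology is weakly compact. -/
def IsRelWeaklyCompact {X : Type*} [NormedAddCommGroup X] [NormedSpace ℝ X] (A : Set X) : Prop :=
  IsCompact (closure (toWeakSpace ℝ X '' A))

/-- Property (d): `(|f n|)` is weak* null for every disjoint weak* null sequence `(f n)` in the
dual. -/
def PropertyD (F : Type*) [NormedAddCommGroup F] [NormedSpace ℝ F] [Lattice F]
    [IsOrderedAddMonoid F] [HasSolidNorm F] : Prop :=
  ∀ f : ℕ → StrongDual ℝ F, DisjointSeq f → WeakStarNull f → WeakStarNull (fun n => |f n|)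

/-- An LW-set: a norm bounded set such that every disjoint sequence in its solid hull
`{y | ∃ x ∈ L, |y| ≤ |x|}` is norm null. -/
def IsLWSet {F : Type*} [NormedAddCommGroup F] [Lattice F] (L : Set F) : Prop :=
  Bornology.IsBounded L ∧
    ∀ y : ℕ → F, (∀ n, y n ∈ LatticeOrderedAddCommGroup.solidClosure L) → DisjointSeq y →
      Tendsto y atTop (𝓝 0)

end Lattice

/-! ### Classes of operators -/

section Operators

/-- The almost L-weakly compact operators: continuous operators mapping relatively weakly compact
sets onto LW-sets. -/
def almostLWeaklyCompact (X F : Type*) [NormedAddCommGroup X] [NormedSpace ℝ X]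
    [NormedAddCommGroup F] [NormedSpace ℝ F] [Lattice F] : Set (X →L[ℝ] F) :=
  {T | ∀ A : Set X, IsRelWeaklyCompact A → IsLWSet (T '' A)}

/-- The almost Grothendieck operators: continuous operators whose adjoint `f ↦ f ∘ T` maps disjoint
weak* null sequences to weakly null sequences. -/
def almostGrothendieck (X F : Type*) [NormedAddCommGroup X] [NormedSpace ℝ X]
    [NormedAddCommGroup F] [NormedSpace ℝ F] [Lattice F] [IsOrderedAddMonoid F]
    [HasSolidNorm F] : Set (X →L[ℝ] F) :=
  {T | ∀ f : ℕ → StrongDual ℝ F, DisjointSeq f → WeakStarNull f →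
    WeaklyNull (fun n => (f n).comp T)}

variable {E F : Type*} [NormedAddCommGroup E] [NormedSpace ℝ E] [Lattice E]
    [NormedAddCommGroup F] [NormedSpace ℝ F] [Lattice F]

/-- A positive operator. -/
def IsPositiveOp (T : E →L[ℝ] F) : Prop := ∀ x : E, 0 ≤ x → 0 ≤ T x

/-- The regularly `P`-operators: differences of two positive members of `P`. -/
def regularly (P : Set (E →L[ℝ] F)) : Set (E →L[ℝ] F) :=
  {T | ∃ T₁ ∈ P, ∃ T₂ ∈ P, IsPositiveOp T₁ ∧ IsPositiveOp T₂ ∧ T = T₁ - T₂}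

end Operators

end BanachLat

/-! Suppose `T` is positive and almost L-weakly compact but `‖T'f_n‖` does not tend to 0. Property
(d) makes `|f_n|` weak* null, and along a subsequence there are positive `x_n` in the unit ball with
`|f_n| (T x_n) ≥ ε`. The engine is a disjointification, `exists_disjoint_minorants`: if positive
weak* null functionals stay away from 0 on a bounded positive sequence, then along a subsequence
they do so on disjoint positive minorants.

It is used twice. In `E`, with the functionals `|f_n| ∘ T`, it gives disjoint `z_k ≤ x_{φ k}`. Since
`E'` is a KB-space, `z` is weakly null (`weaklyNull_of_disjointSeq`), so the set of all `T z_k` is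
an LW-set. In `F`, with the `|f_n|` themselves, it gives disjoint `w_k` below terms of `T z`. These
lie in the solid hull, so `‖w_k‖ → 0`, although the bounded functionals are at least `ε / 4` on
them.

Part (2) reduces to (1): an order continuous dual norm gives a KB-space (`isKBSpace_dual`), and
order continuity in `F` makes bounded disjoint sequences of positive functionals weak* null, whence
(d) (`propertyD`). -/

namespace BanachLat

/-! ### Weak and weak* null sequences. -/

section Weak

variable {X : Type*} [NormedAddCommGroup X] [NormedSpace ℝ X]

theorem weakStarNull_iff {f : ℕ → StrongDual ℝ X} :
    WeakStarNull f ↔ ∀ x, Tendsto (fun n => f n x) atTop (𝓝 0) := by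
  unfold WeakStarNull
  rw [tendsto_iff_forall_eval_tendsto_topDualPairing]
  rfl

theorem weaklyNull_iff {x : ℕ → X} :
    WeaklyNull x ↔ ∀ g : StrongDual ℝ X, Tendsto (fun n => g (x n)) atTop (𝓝 0) := by
  have hinj : Function.Injective (topDualPairing ℝ X).flip := by
    intro a b h
    exact SeparatingDual.eq_iff_forall_dual_eq.2 fun g => DFunLike.congr_fun h g
  refine (WeakBilin.tendsto_iff_forall_eval_tendsto _ hinj).trans (forall_congr' fun g => ?_)
  have : (topDualPairing ℝ X).flip 0 g = 0 := by simp
  exact Iff.of_eq (congrArg (Tendsto _ atTop) (congrArg 𝓝 this))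

/-- A convergent sequence together with its limit is compact, hence closed in the Hausdorff weak
topology. -/
theorem WeaklyNull.isRelWeaklyCompact {x : ℕ → X} (hx : WeaklyNull x) :
    IsRelWeaklyCompact (Set.range x) := by
  have hc := hx.isCompact_insert_range
  refine hc.of_isClosed_subset isClosed_closure (closure_minimal ?_ hc.isClosed)
  rw [← Set.range_comp]
  exact Set.subset_insert _ _

theorem WeakStarNull.exists_norm_le [CompleteSpace X] {f : ℕ → StrongDual ℝ X}
    (hf : WeakStarNull f) : ∃ M, ∀ n, ‖f n‖ ≤ M := by
  refine banach_steinhaus fun x => ?_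
  obtain ⟨C, hC⟩ := (weakStarNull_iff.1 hf x).norm.bddAbove_range
  exact ⟨C, fun n => hC ⟨n, rfl⟩⟩

theorem WeakStarNull.comp_tendsto {f : ℕ → StrongDual ℝ X} (hf : WeakStarNull f) {φ : ℕ → ℕ}
    (hφ : Tendsto φ atTop atTop) : WeakStarNull fun n => f (φ n) :=
  weakStarNull_iff.2 fun x => (weakStarNull_iff.1 hf x).comp hφ

theorem apply_le_mul {f : StrongDual ℝ X} {M C : ℝ} (hf : ‖f‖ ≤ M) {x : X} (hx : ‖x‖ ≤ C) :
    f x ≤ M * C :=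
  (le_abs_self _).trans (f.le_of_opNorm_le_of_le hf hx)

end Weak

/-! ### Disjointness in lattice-ordered groups. -/

section LatticeGroup

variable {G : Type*} [Lattice G] [AddCommGroup G]

theorem disjointSeq_of_lt {x : ℕ → G} (h : ∀ m n, m < n → |x m| ⊓ |x n| = 0) :
    DisjointSeq x := fun m n hmn => by
  rcases hmn.lt_or_gt with h' | h'
  · exact h m n h'
  · rw [inf_comm]
    exact h n m h'

theorem DisjointSeq.comp_injective {x : ℕ → G} (hx : DisjointSeq x) {φ : ℕ → ℕ}
    (hφ : Function.Injective φ) : DisjointSeq fun n => x (φ n) :=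
  fun _ _ hmn => hx _ _ (hφ.ne hmn)

variable [IsOrderedAddMonoid G]

theorem inf_add_le_of_nonneg {a b c : G} (ha : 0 ≤ a) (hb : 0 ≤ b) (hc : 0 ≤ c) :
    a ⊓ (b + c) ≤ a ⊓ b + a ⊓ c := by
  rw [inf_add, add_inf, add_inf]
  refine le_inf (le_inf ?_ ?_) (le_inf ?_ ?_)
  · exact inf_le_left.trans (le_add_of_nonneg_left ha)
  · exact inf_le_left.trans (le_add_of_nonneg_right hc)
  · exact inf_le_left.trans (le_add_of_nonneg_left hb)
  · exact inf_le_right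

theorem inf_add_eq_zero {a b c : G} (ha : 0 ≤ a) (hb : 0 ≤ b) (hc : 0 ≤ c)
    (hab : a ⊓ b = 0) (hac : a ⊓ c = 0) : a ⊓ (b + c) = 0 := by
  refine le_antisymm ?_ (le_inf ha (add_nonneg hb hc))
  simpa [hab, hac] using inf_add_le_of_nonneg ha hb hc

theorem inf_nsmul_eq_zero {a b : G} (ha : 0 ≤ a) (hb : 0 ≤ b) (hab : a ⊓ b = 0) (n : ℕ) :
    a ⊓ n • b = 0 := by
  induction n with
  | zero => simpa using ha
  | succ n ih =>
    rw [succ_nsmul]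
    exact inf_add_eq_zero ha (nsmul_nonneg hb n) hb ih hab

theorem inf_sum_eq_zero {ι : Type*} {a : G} {b : ι → G} (ha : 0 ≤ a) (hb : ∀ i, 0 ≤ b i)
    (s : Finset ι) (hab : ∀ i ∈ s, a ⊓ b i = 0) : a ⊓ ∑ i ∈ s, b i = 0 := by
  classical
  induction s using Finset.induction_on with
  | empty => simpa using ha
  | insert i s hi ih =>
    rw [Finset.sum_insert hi]
    exact inf_add_eq_zero ha (hb i) (Finset.sum_nonneg fun j _ => hb j)
      (hab i (Finset.mem_insert_self i s))
      (ih fun j hj => hab j (Finset.mem_insert_of_mem hj))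

theorem DisjointSeq.abs {x : ℕ → G} (hx : DisjointSeq x) : DisjointSeq fun n => |x n| :=
  fun m n hmn => by simpa only [abs_abs] using hx m n hmn

end LatticeGroup

/-! ### Components of functionals; disjoint sequences when the dual is a KB-space. -/

section Dual

variable {G : Type*} [NormedAddCommGroup G] [NormedSpace ℝ G] [Lattice G]
  [IsOrderedAddMonoid G]

theorem apply_le_apply {f : StrongDual ℝ G} (hf : 0 ≤ f) {x y : G} (hxy : x ≤ y) :
    f x ≤ f y := by
  have := hf (y - x) (sub_nonneg.2 hxy)
  rw [map_sub] at this
  simpa using this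

theorem apply_nonneg {f : StrongDual ℝ G} (hf : 0 ≤ f) {x : G} (hx : 0 ≤ x) : 0 ≤ f x :=
  hf x hx

variable [HasSolidNorm G]

/-- Disjoint positive functionals are almost concentrated on complementary parts of an order
interval. -/
theorem exists_mem_Icc_of_inf_eq_zero {f g : StrongDual ℝ G} (h : f ⊓ g = 0) {x : G}
    (hx : 0 ≤ x) {δ : ℝ} (hδ : 0 < δ) :
    ∃ y ∈ Set.Icc 0 x, f (x - y) + g y < δ := by
  -- Disjointness means `f = (f - g)⁺`, so `f x` is the supremum of `f - g` over `[0, x]`; `y` is a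
  -- near-maximizer.
  have h0 : f - dualPosPart (f - g) = 0 := h
  have h1 : f x = supIcc (f - g) x := by
    rw [← dualPosPart_apply _ hx, ← sub_eq_zero.1 h0]
  obtain ⟨_, ⟨y, hy, rfl⟩, hlt⟩ := exists_lt_of_lt_csSup
    (s := (f - g) '' Set.Icc 0 x) ⟨_, 0, ⟨le_rfl, hx⟩, rfl⟩ (sub_lt_self (supIcc (f - g) x) hδ)
  refine ⟨y, hy, ?_⟩
  rw [← h1] at hlt
  simp only [sub_apply, map_sub] at hlt ⊢
  linarith

/-- Kantorovich extension: an additive map on the cone extends through `x = x⁺ - x⁻`, and domination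
by `g` makes the extension continuous. -/
theorem exists_dual_of_additive {φ : G → ℝ} (g : StrongDual ℝ G) (h0 : ∀ x, 0 ≤ x → 0 ≤ φ x)
    (hg : ∀ x, 0 ≤ x → φ x ≤ g x) (hadd : ∀ x y, 0 ≤ x → 0 ≤ y → φ (x + y) = φ x + φ y) :
    ∃ h : StrongDual ℝ G, ∀ x, 0 ≤ x → h x = φ x := by
  have key : ∀ x a b : G, 0 ≤ a → 0 ≤ b → x = a - b → φ x⁺ - φ x⁻ = φ a - φ b := by
    intro x a b ha hb hx
    have e : x⁺ + b = a + x⁻ := by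
      rw [← sub_eq_sub_iff_add_eq_add, posPart_sub_negPart, hx]
    have e' := congrArg φ e
    rw [hadd _ _ (posPart_nonneg x) hb, hadd _ _ ha (negPart_nonneg x)] at e'
    linarith
  have hφ0 : φ 0 = 0 := by
    have := hadd 0 0 le_rfl le_rfl
    rw [add_zero] at this
    linarith
  let H : G →+ ℝ :=
    { toFun := fun x => φ x⁺ - φ x⁻
      map_zero' := by simp
      map_add' := fun x y => by
        rw [key (x + y) (x⁺ + y⁺) (x⁻ + y⁻) (add_nonneg (posPart_nonneg x) (posPart_nonneg y))
          (add_nonneg (negPart_nonneg x) (negPart_nonneg y))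
          (by rw [add_sub_add_comm, posPart_sub_negPart, posPart_sub_negPart]),
          hadd _ _ (posPart_nonneg x) (posPart_nonneg y),
          hadd _ _ (negPart_nonneg x) (negPart_nonneg y)]
        ring }
  have hH : Continuous H := by
    refine AddMonoidHomClass.continuous_of_bound H ‖g‖ fun x => ?_
    have h1 := h0 _ (posPart_nonneg x)
    have h2 := h0 _ (negPart_nonneg x)
    have h3 := hg _ (posPart_nonneg x)
    have h4 := hg _ (negPart_nonneg x)
    have h5 : g x⁺ + g x⁻ ≤ ‖g‖ * ‖x‖ := by
      rw [← map_add, posPart_add_negPart]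
      exact apply_le_mul le_rfl (norm_abs_eq_norm x).le
    change |φ x⁺ - φ x⁻| ≤ _
    rw [abs_le]
    constructor <;> linarith
  refine ⟨H.toRealLinearMap hH, fun x hx => ?_⟩
  change φ x⁺ - φ x⁻ = φ x
  rw [key x x 0 hx le_rfl (sub_zero x).symm, hφ0, sub_zero]

/-- The component of a positive functional `g` on the ideal generated by `u`. -/
theorem exists_component {g : StrongDual ℝ G} (hg : 0 ≤ g) {u : G} (hu : 0 ≤ u) :
    ∃ h : StrongDual ℝ G, ∀ x, 0 ≤ x →
      Tendsto (fun n : ℕ => g (x ⊓ n • u)) atTop (𝓝 (h x)) := by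
  have hmono : ∀ x : G, Monotone fun n : ℕ => g (x ⊓ n • u) := fun x m n hmn =>
    apply_le_apply hg (inf_le_inf_left _ (nsmul_le_nsmul_left hu hmn))
  have hle : ∀ x : G, ∀ n : ℕ, g (x ⊓ n • u) ≤ g x := fun x n => apply_le_apply hg inf_le_left
  have hlim : ∀ x : G, Tendsto (fun n : ℕ => g (x ⊓ n • u)) atTop
      (𝓝 (⨆ n : ℕ, g (x ⊓ n • u))) := fun x =>
    tendsto_atTop_ciSup (hmono x) ⟨g x, by rintro _ ⟨n, rfl⟩; exact hle x n⟩
  obtain ⟨h, hh⟩ := exists_dual_of_additive (φ := fun x => ⨆ n : ℕ, g (x ⊓ n • u)) g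
    (fun x hx => ge_of_tendsto' (hlim x) fun n =>
      apply_nonneg hg (le_inf hx (nsmul_nonneg hu n)))
    (fun x _ => le_of_tendsto' (hlim x) (hle x))
    (fun x y hx hy => by
      refine le_antisymm ?_ ?_
      · refine le_of_tendsto_of_tendsto' (hlim (x + y)) ((hlim x).add (hlim y)) fun n => ?_
        rw [← map_add, inf_comm, inf_comm x, inf_comm y]
        exact apply_le_apply hg (inf_add_le_of_nonneg (nsmul_nonneg hu n) hx hy)
      · refine le_of_tendsto' ((hlim x).add (hlim y)) fun n => ?_
        -- Superadditivity holds only after doubling the index: `x ⊓ n • u + y ⊓ n • u ≤ (x + y) ⊓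
        -- (n + n) • u`.
        refine le_trans ?_ ((hmono (x + y)).ge_of_tendsto (hlim (x + y)) (n + n))
        rw [← map_add]
        refine apply_le_apply hg (le_inf (add_le_add inf_le_left inf_le_left) ?_)
        rw [add_nsmul]
        exact add_le_add inf_le_right inf_le_right)
  exact ⟨h, fun x hx => by rw [hh x hx]; exact hlim x⟩

/-- If the dual is a KB-space, disjoint bounded positive sequences are weakly null. -/
theorem tendsto_apply_of_disjointSeq (hKB : IsKBSpace (StrongDual ℝ G)) {g : StrongDual ℝ G}
    (hg : 0 ≤ g) {z : ℕ → G} (hz : ∀ n, 0 ≤ z n) (hd : DisjointSeq z) {C : ℝ}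
    (hC : ∀ n, ‖z n‖ ≤ C) : Tendsto (fun n => g (z n)) atTop (𝓝 0) := by
  have hs : ∀ k, 0 ≤ ∑ i ∈ Finset.range k, z i := fun k => Finset.sum_nonneg fun i _ => hz i
  -- `h k` is the component of `g` on the ideal generated by `z 0, ..., z (k - 1)`. These components
  -- increase below `g`, so the KB property makes consecutive differences norm null.
  choose h hh using fun k => exists_component hg (hs k)
  have hnonneg : ∀ k, 0 ≤ h k := fun k x hx => ge_of_tendsto' (hh k x hx) fun n =>
    apply_nonneg hg (le_inf hx (nsmul_nonneg (hs k) n))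
  have hle : ∀ k, h k ≤ g := fun k x hx => le_of_tendsto' (hh k x hx) fun n =>
    apply_le_apply hg inf_le_left
  have hmono : Monotone h := fun k l hkl x hx =>
    le_of_tendsto_of_tendsto' (hh k x hx) (hh l x hx) fun n =>
      apply_le_apply hg (inf_le_inf_left _ (nsmul_le_nsmul_right
        (Finset.sum_le_sum_of_subset_of_nonneg (Finset.range_mono hkl) fun i _ _ => hz i) n))
  have hbdd : Bornology.IsBounded (Set.range h) := by
    refine (Metric.isBounded_closedBall (x := 0) (r := ‖g‖)).subset ?_
    rintro _ ⟨k, rfl⟩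
    rw [mem_closedBall_zero_iff]
    refine norm_le_norm_of_abs_le_abs ?_
    rw [abs_of_nonneg (hnonneg k), abs_of_nonneg hg]
    exact hle k
  obtain ⟨l, hl⟩ := hKB h hnonneg hmono hbdd
  have hdiff : Tendsto (fun k => ‖h (k + 1) - h k‖) atTop (𝓝 0) := by
    simpa using ((hl.comp (tendsto_add_atTop_nat 1)).sub hl).norm
  -- `z k` lies in the ideal defining `h (k + 1)` and is disjoint from the one defining `h k`.
  have hval : ∀ k, g (z k) = (h (k + 1) - h k) (z k) := by
    intro k
    have h1 : h (k + 1) (z k) = g (z k) := by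
      refine tendsto_nhds_unique (hh (k + 1) (z k) (hz k)) ?_
      refine tendsto_const_nhds.congr' ?_
      filter_upwards [eventually_ge_atTop 1] with n hn
      rw [inf_eq_left.2]
      calc z k ≤ ∑ i ∈ Finset.range (k + 1), z i :=
            Finset.single_le_sum (fun i _ => hz i) (Finset.self_mem_range_succ k)
        _ ≤ n • ∑ i ∈ Finset.range (k + 1), z i := by
            simpa using nsmul_le_nsmul_left (hs (k + 1)) hn
    have h2 : h k (z k) = 0 := by
      refine tendsto_nhds_unique (hh k (z k) (hz k)) (tendsto_const_nhds.congr fun n => ?_)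
      rw [inf_nsmul_eq_zero (hz k) (hs k), map_zero]
      refine inf_sum_eq_zero (hz k) hz _ fun i hi => ?_
      have := hd k i (Finset.mem_range.1 hi).ne'
      rwa [abs_of_nonneg (hz k), abs_of_nonneg (hz i)] at this
    rw [sub_apply, h1, h2, sub_zero]
  refine squeeze_zero (fun n => apply_nonneg hg (hz n)) (fun n => ?_)
    (by simpa using hdiff.mul_const C)
  rw [hval]
  exact apply_le_mul le_rfl (hC n)

theorem weaklyNull_of_disjointSeq (hKB : IsKBSpace (StrongDual ℝ G)) {z : ℕ → G}
    (hz : ∀ n, 0 ≤ z n) (hd : DisjointSeq z) {C : ℝ} (hC : ∀ n, ‖z n‖ ≤ C) : WeaklyNull z := by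
  refine weaklyNull_iff.2 fun g => ?_
  refine squeeze_zero_norm (fun n => ?_)
    (tendsto_apply_of_disjointSeq hKB (abs_nonneg g) hz hd hC)
  simpa only [Real.norm_eq_abs, abs_of_nonneg (hz n)] using abs_apply_le_dual_abs g (z n)

end Dual

/-! ### Extraction of disjoint minorants. -/

section Minorants

variable {G : Type*} [NormedAddCommGroup G] [NormedSpace ℝ G]

/-- A subsequence along which the mixed terms `f (φ k) (x (φ j))`, `j < k`, decay rapidly. -/
theorem exists_strictMono_mixed_le {f : ℕ → StrongDual ℝ G} (hf : WeakStarNull f) (x : ℕ → G)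
    {δ : ℕ → ℝ} (hδ : ∀ k, 0 < δ k) (hanti : Antitone δ) :
    ∃ φ : ℕ → ℕ, StrictMono φ ∧ ∀ j k, j < k → f (φ k) (x (φ j)) ≤ δ k := by
  -- The selection relation cannot see the position `k` in the sequence, so each index carries a
  -- strictly increasing counter `p ≥ k`; antitonicity turns the bound `δ p` into `δ k`.
  obtain ⟨a, -, ha⟩ := exists_seq_of_forall_finset_exists (α := ℕ × ℕ) (fun _ => True)
    (fun a b => a.1 < b.1 ∧ a.2 < b.2 ∧ f b.2 (x a.2) ≤ δ b.1) (fun s _ => by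
      have h1 : ∀ᶠ p in atTop, ∀ a ∈ s, a.1 < p :=
        (eventually_all_finset s).2 fun a _ => eventually_gt_atTop a.1
      obtain ⟨p, hp⟩ := h1.exists
      have h2 : ∀ᶠ n in atTop, ∀ a ∈ s, a.2 < n ∧ f n (x a.2) ≤ δ p :=
        (eventually_all_finset s).2 fun a _ => (eventually_gt_atTop a.2).and
          ((weakStarNull_iff.1 hf (x a.2)).eventually_le_const (hδ p))
      obtain ⟨n, hn⟩ := h2.exists
      exact ⟨(p, n), trivial, fun a h => ⟨hp a h, hn a h⟩⟩)
  have hp : StrictMono fun k => (a k).1 := strictMono_nat_of_lt_succ fun k =>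
    (ha k (k + 1) k.lt_succ_self).1
  exact ⟨fun k => (a k).2, fun j k hjk => (ha j k hjk).2.1,
    fun j k hjk => (ha j k hjk).2.2.trans (hanti (hp.le_apply))⟩

variable [CompleteSpace G] [Lattice G] [IsOrderedAddMonoid G] [IsOrderedModule ℝ G]
  [HasSolidNorm G]

/-- If `f k (v j)` is small for `j < k`, then `v k` has disjoint positive minorants `z k` on which
`f k` is almost as large as on `v k`. -/
theorem exists_disjoint_minorants_of_mixed_le {g : ℕ → StrongDual ℝ G} (hg : ∀ k, 0 ≤ g k)
    {M : ℝ} (hM : ∀ k, ‖g k‖ ≤ M) {v : ℕ → G} (hv : ∀ k, 0 ≤ v k) {C : ℝ}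
    (hC : ∀ k, ‖v k‖ ≤ C) {δ : ℝ} (hδ : 0 < δ)
    (hmix : ∀ j k, j < k → g k (v j) ≤ δ * (1 / 8) ^ k) :
    ∃ z : ℕ → G, (∀ k, 0 ≤ z k) ∧ (∀ k, z k ≤ v k) ∧ DisjointSeq z ∧
      ∀ᶠ k in atTop, g k (v k) - 2 * δ ≤ g k (z k) := by
  have hsum : Summable fun i => (1 / 2 : ℝ) ^ i • v i := by
    refine Summable.of_norm_bounded (g := fun i => (1 / 2 : ℝ) ^ i * C)
      (summable_geometric_two.mul_right C) fun i => ?_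
    rw [norm_smul, norm_pow, Real.norm_of_nonneg (by norm_num)]
    exact mul_le_mul_of_nonneg_left (hC i) (by positivity)
  set S := ∑' i, (1 / 2 : ℝ) ^ i • v i with hS
  have hterm : ∀ i, 0 ≤ (1 / 2 : ℝ) ^ i • v i := fun i => smul_nonneg (by positivity) (hv i)
  have hS0 : 0 ≤ S := tsum_nonneg hterm
  have hSle : ∀ i, (1 / 2 : ℝ) ^ i • v i ≤ S := fun i =>
    hsum.le_tsum i fun j _ => hterm j
  -- In `z k = (v k - A k - B k)⁺`, `A k` makes `z k` disjoint from earlier terms and `B k` from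
  -- later ones.
  let A : ℕ → G := fun k => (4 : ℝ) ^ k • ∑ j ∈ Finset.range k, v j
  let B : ℕ → G := fun k => (1 / 2 : ℝ) ^ k • S
  have hA0 : ∀ k, 0 ≤ A k := fun k =>
    smul_nonneg (by positivity) (Finset.sum_nonneg fun j _ => hv j)
  have hB0 : ∀ k, 0 ≤ B k := fun k => smul_nonneg (by positivity) hS0
  refine ⟨fun k => (v k - A k - B k)⁺, fun k => posPart_nonneg _, fun k => ?_, ?_, ?_⟩
  · refine sup_le ?_ (hv k)
    exact (sub_le_self _ (hB0 k)).trans (sub_le_self _ (hA0 k))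
  · refine disjointSeq_of_lt fun j k hjk => ?_
    rw [abs_of_nonneg (posPart_nonneg _), abs_of_nonneg (posPart_nonneg _)]
    -- Disjointness of `z k` and `z j` follows from `z k ≤ u⁺` and `z j ≤ u⁻`.
    set u := v k - (4 : ℝ) ^ k • v j with hu
    have h1 : (v k - A k - B k)⁺ ≤ u⁺ := by
      refine posPart_mono ((sub_le_self _ (hB0 k)).trans (sub_le_sub_left ?_ _))
      exact smul_le_smul_of_nonneg_left
        (Finset.single_le_sum (fun i _ => hv i) (Finset.mem_range.2 hjk)) (by positivity)
    have h2 : (v j - A j - B j)⁺ ≤ u⁻ := by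
      refine sup_le ?_ (negPart_nonneg u)
      have e1 : v j - (1 / 4 : ℝ) ^ k • v k = (1 / 4 : ℝ) ^ k • (-u) := by
        rw [hu, neg_sub, smul_sub, smul_smul, ← mul_pow]
        norm_num
      have e2 : (1 / 4 : ℝ) ^ k • v k ≤ B j := by
        refine le_trans ?_ (smul_le_smul_of_nonneg_left (hSle k) (by positivity))
        rw [smul_smul]
        refine smul_le_smul_of_nonneg_right ?_ (hv k)
        calc (1 / 4 : ℝ) ^ k = (1 / 2) ^ k * (1 / 2) ^ k := by rw [← mul_pow]; norm_num
          _ ≤ (1 / 2) ^ j * (1 / 2) ^ k := mul_le_mul_of_nonneg_right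
            (pow_le_pow_of_le_one (by norm_num) (by norm_num) hjk.le) (by positivity)
      calc v j - A j - B j ≤ v j - B j := sub_le_sub_right (sub_le_self _ (hA0 j)) _
        _ ≤ v j - (1 / 4 : ℝ) ^ k • v k := sub_le_sub_left e2 _
        _ = (1 / 4 : ℝ) ^ k • (-u) := e1
        _ ≤ (1 / 4 : ℝ) ^ k • u⁻ :=
          smul_le_smul_of_nonneg_left (neg_le_negPart u) (by positivity)
        _ ≤ (1 : ℝ) • u⁻ := smul_le_smul_of_nonneg_right
          (pow_le_one₀ (by norm_num) (by norm_num)) (negPart_nonneg u)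
        _ = u⁻ := one_smul _ _
    refine le_antisymm ?_ (le_inf (posPart_nonneg _) (posPart_nonneg _))
    calc _ ≤ u⁻ ⊓ u⁺ := inf_le_inf h2 h1
      _ = 0 := by rw [inf_comm, posPart_inf_negPart_eq_zero]
  · have hsmall : Tendsto (fun k : ℕ => (1 / 2 : ℝ) ^ k * (M * ‖S‖)) atTop (𝓝 0) := by
      simpa using (tendsto_pow_atTop_nhds_zero_of_lt_one (r := (1 / 2 : ℝ))
        (by norm_num) (by norm_num)).mul_const (M * ‖S‖)
    filter_upwards [hsmall.eventually_le_const hδ] with k hk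
    -- The factor `8⁻ᵏ` in `hmix` absorbs `4ᵏ` and the `k` summands, as `k 2⁻ᵏ ≤ 1`.
    have hA : g k (A k) ≤ δ := by
      simp only [A, map_smul, map_sum, smul_eq_mul]
      have hk1 : (k : ℝ) * (1 / 2) ^ k ≤ 1 := by
        rw [one_div, inv_pow, ← div_eq_mul_inv, div_le_one (by positivity)]
        exact_mod_cast k.lt_two_pow_self.le
      calc (4 : ℝ) ^ k * ∑ j ∈ Finset.range k, g k (v j)
          ≤ 4 ^ k * ∑ j ∈ Finset.range k, δ * (1 / 8) ^ k :=
            mul_le_mul_of_nonneg_left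
              (Finset.sum_le_sum fun j hj => hmix j k (Finset.mem_range.1 hj)) (by positivity)
        _ = δ * (k * (4 ^ k * (1 / 8) ^ k)) := by
            rw [Finset.sum_const, Finset.card_range, nsmul_eq_mul]; ring
        _ = δ * (k * (1 / 2) ^ k) := by rw [← mul_pow]; norm_num
        _ ≤ δ := mul_le_of_le_one_right hδ.le hk1
    have hB : g k (B k) ≤ δ := by
      simp only [B, map_smul, smul_eq_mul]
      exact (mul_le_mul_of_nonneg_left (apply_le_mul (hM k) le_rfl) (by positivity)).trans hk
    have := apply_le_apply (hg k) (le_posPart (v k - A k - B k))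
    rw [map_sub, map_sub] at this
    linarith

theorem exists_disjoint_minorants {f : ℕ → StrongDual ℝ G} (hf0 : ∀ n, 0 ≤ f n)
    (hf : WeakStarNull f) {x : ℕ → G} (hx : ∀ n, 0 ≤ x n) {C : ℝ} (hC : ∀ n, ‖x n‖ ≤ C)
    {ε : ℝ} (hε : 0 < ε) (hfx : ∀ n, ε ≤ f n (x n)) :
    ∃ (φ : ℕ → ℕ) (z : ℕ → G), StrictMono φ ∧ (∀ k, 0 ≤ z k) ∧ (∀ k, z k ≤ x (φ k)) ∧
      DisjointSeq z ∧ ∀ k, ε / 2 ≤ f (φ k) (z k) := by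
  obtain ⟨M, hM⟩ := hf.exists_norm_le
  -- With `δ = ε / 4` the loss `2 * δ` is `ε / 2`. The estimate holds only eventually, hence the
  -- later shift by `N`.
  obtain ⟨φ, hφ, hmix⟩ := exists_strictMono_mixed_le hf x
    (δ := fun k => ε / 4 * (1 / 8) ^ k) (fun k => by positivity) fun j k hjk =>
      mul_le_mul_of_nonneg_left (pow_le_pow_of_le_one (by norm_num) (by norm_num) hjk)
        (by positivity)
  obtain ⟨z, hz0, hzx, hzd, hz⟩ := exists_disjoint_minorants_of_mixed_le
    (g := fun k => f (φ k)) (v := fun k => x (φ k)) (fun k => hf0 _) (fun k => hM _)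
    (fun k => hx _) (fun k => hC _) (δ := ε / 4) (by positivity) hmix
  obtain ⟨N, hN⟩ := eventually_atTop.1 hz
  refine ⟨fun k => φ (k + N), fun k => z (k + N), fun j k hjk => hφ (by omega),
    fun k => hz0 _, fun k => hzx _, hzd.comp_injective (add_left_injective N), fun k => ?_⟩
  have h1 := hN (k + N) (Nat.le_add_left N k)
  have h2 := hfx (φ (k + N))
  linarith

end Minorants

/-! ### Positive almost L-weakly compact operators. -/

section Operators

variable {E : Type*} [NormedAddCommGroup E] [NormedSpace ℝ E] [CompleteSpace E] [Lattice E]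
  [IsOrderedAddMonoid E] [IsOrderedModule ℝ E] [HasSolidNorm E]
  {F : Type*} [NormedAddCommGroup F] [NormedSpace ℝ F] [CompleteSpace F] [Lattice F]
  [IsOrderedAddMonoid F] [IsOrderedModule ℝ F] [HasSolidNorm F]

/-- Positive weak* null functionals cannot stay away from zero on the image of a bounded positive
sequence under a positive almost L-weakly compact operator. -/
theorem almostLWeaklyCompact_not_forall_le_apply (hKB : IsKBSpace (StrongDual ℝ E)) {T : E →L[ℝ] F}
    (hT : T ∈ almostLWeaklyCompact E F) (hpos : IsPositiveOp T) {f : ℕ → StrongDual ℝ F}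
    (hf0 : ∀ n, 0 ≤ f n) (hf : WeakStarNull f) {x : ℕ → E} (hx0 : ∀ n, 0 ≤ x n)
    (hx1 : ∀ n, ‖x n‖ ≤ 1) {ε : ℝ} (hε : 0 < ε) : ¬ ∀ n, ε ≤ f n (T (x n)) := by
  intro h
  have hfT : WeakStarNull fun n => (f n).comp T :=
    weakStarNull_iff.2 fun y => weakStarNull_iff.1 hf (T y)
  -- First disjointification, in `E`.
  obtain ⟨φ, z, hφ, hz0, hzx, hzd, hz⟩ := exists_disjoint_minorants
    (f := fun n => (f n).comp T) (fun n y hy => hf0 n _ (hpos y hy)) hfT hx0 hx1 hε h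
  have hz1 : ∀ k, ‖z k‖ ≤ 1 := fun k =>
    (norm_le_of_mem_Icc ⟨hz0 k, hzx k⟩).trans (hx1 _)
  obtain ⟨hbdd, hLW⟩ := hT _ (weaklyNull_of_disjointSeq hKB hz0 hzd hz1).isRelWeaklyCompact
  -- Second one, in `F`: `T z` need not be disjoint, but its minorants `w` are, and they lie in the
  -- solid hull of an LW-set.
  obtain ⟨ψ, w, -, hw0, hwz, hwd, hw⟩ := exists_disjoint_minorants (fun k => hf0 (φ k))
    (hf.comp_tendsto hφ.tendsto_atTop) (x := fun k => T (z k)) (fun k => hpos _ (hz0 k))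
    (C := ‖T‖ * 1) (fun k => T.le_of_opNorm_le_of_le le_rfl (hz1 k)) (half_pos hε) hz
  have hwlim := hLW w (fun k => ⟨T (z (ψ k)), ⟨_, ⟨_, rfl⟩, rfl⟩, by
    rw [abs_of_nonneg (hw0 k), abs_of_nonneg (hpos _ (hz0 _))]
    exact hwz k⟩) hwd
  obtain ⟨M, hM⟩ := hf.exists_norm_le
  have hlim : Tendsto (fun k => M * ‖w k‖) atTop (𝓝 0) := by simpa using hwlim.norm.const_mul M
  obtain ⟨k, hk⟩ := (hlim.eventually_lt_const (half_pos (half_pos hε))).exists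
  exact absurd ((hw k).trans (apply_le_mul (hM _) le_rfl)) (not_le.2 hk)

theorem norm_comp_tendsto_zero (hKB : IsKBSpace (StrongDual ℝ E)) (hd : PropertyD F)
    {T : E →L[ℝ] F} (hT : T ∈ almostLWeaklyCompact E F) (hpos : IsPositiveOp T)
    {f : ℕ → StrongDual ℝ F} (hfd : DisjointSeq f) (hf : WeakStarNull f) :
    Tendsto (fun n => ‖(f n).comp T‖) atTop (𝓝 0) := by
  by_contra hnot
  obtain ⟨ε, hε, hfreq⟩ : ∃ ε > 0, ∃ᶠ n in atTop, ε ≤ ‖(f n).comp T‖ := by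
    by_contra! hcon
    refine hnot (tendsto_order.2 ⟨fun a ha => .of_forall fun n => ha.trans_le (norm_nonneg _),
      fun a ha => ?_⟩)
    simpa only [not_frequently, not_le] using hcon a ha
  obtain ⟨φ, hφ, hφε⟩ := extraction_of_frequently_atTop hfreq
  have hex : ∀ n, ∃ x : E, 0 ≤ x ∧ ‖x‖ ≤ 1 ∧ ε / 2 ≤ |f (φ n)| (T x) := by
    intro n
    obtain ⟨x, hx1, hx⟩ := ((f (φ n)).comp T).exists_lt_apply_of_lt_opNorm
      ((half_lt_self hε).trans_le (hφε n))
    refine ⟨|x|, abs_nonneg x, (norm_abs_eq_norm x).trans_le hx1.le, hx.le.trans ?_⟩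
    -- Positivity of `T` gives `|T x| ≤ T |x|`, so the norming vector may be replaced by its
    -- modulus.
    refine (abs_apply_le_dual_abs (f (φ n)) (T x)).trans (apply_le_apply (abs_nonneg _) (abs_le'.2 ⟨?_, ?_⟩))
    · simpa using hpos _ (sub_nonneg.2 (le_abs_self x))
    · have := hpos _ (sub_nonneg.2 (neg_le_abs x))
      rwa [map_sub, map_neg, sub_nonneg] at this
  choose x hx0 hx1 hx using hex
  exact almostLWeaklyCompact_not_forall_le_apply hKB hT hpos (fun n => abs_nonneg (f (φ n)))
    ((hd f hfd hf).comp_tendsto hφ.tendsto_atTop) hx0 hx1 (half_pos hε) hx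

theorem regularly_almostLWeaklyCompact_subset (hKB : IsKBSpace (StrongDual ℝ E))
    (hd : PropertyD F) :
    regularly (almostLWeaklyCompact E F) ⊆ regularly (almostGrothendieck E F) := by
  have key : ∀ T ∈ almostLWeaklyCompact E F, IsPositiveOp T → T ∈ almostGrothendieck E F := by
    intro T hT hpos f hfd hf
    refine weaklyNull_iff.2 fun g => ?_
    have h := tendsto_zero_iff_norm_tendsto_zero.2 (norm_comp_tendsto_zero hKB hd hT hpos hfd hf)
    simpa [Function.comp_def] using (g.continuous.tendsto 0).comp h
  rintro _ ⟨T₁, h₁, T₂, h₂, hp₁, hp₂, rfl⟩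
  exact ⟨T₁, key T₁ h₁ hp₁, T₂, key T₂ h₂ hp₂, hp₁, hp₂, rfl⟩

end Operators

/-! ### Consequences of order continuous norms. -/

section OrderContinuous

/-- The dual of a Banach lattice is a KB-space if its norm is order continuous. -/
theorem HasOrderContinuousNorm.isKBSpace_dual {E : Type*} [NormedAddCommGroup E]
    [NormedSpace ℝ E] [CompleteSpace E] [Lattice E] [IsOrderedAddMonoid E] [HasSolidNorm E]
    (h : HasOrderContinuousNorm (StrongDual ℝ E)) : IsKBSpace (StrongDual ℝ E) := by
  intro f hf0 hmono hbdd
  obtain ⟨M, hM⟩ := hbdd.exists_norm_le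
  have hlim0 : ∀ x : E, 0 ≤ x → ∃ l, Tendsto (fun n => f n x) atTop (𝓝 l) := fun x hx =>
    ⟨_, tendsto_atTop_ciSup (fun m n hmn => hmono hmn x hx) ⟨M * ‖x‖, by
      rintro _ ⟨n, rfl⟩
      exact apply_le_mul (hM _ ⟨n, rfl⟩) le_rfl⟩⟩
  have hlim : ∀ x : E, ∃ l, Tendsto (fun n => f n x) atTop (𝓝 l) := fun x => by
    obtain ⟨a, ha⟩ := hlim0 _ (posPart_nonneg x)
    obtain ⟨b, hb⟩ := hlim0 _ (negPart_nonneg x)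
    refine ⟨a - b, (ha.sub hb).congr fun n => ?_⟩
    rw [← map_sub, posPart_sub_negPart]
  choose l hl using hlim
  -- The pointwise limit is continuous by Banach–Steinhaus, and `g - f n` decreases to 0.
  let g : StrongDual ℝ E := continuousLinearMapOfTendsto (fun n => f n) (tendsto_pi_nhds.2 hl)
  have hfg : ∀ n, f n ≤ g := fun n x hx =>
    (show Monotone fun n => f n x from fun m n hmn => hmono hmn x hx).ge_of_tendsto (hl x) n
  refine ⟨g, tendsto_iff_norm_sub_tendsto_zero.2 ?_⟩
  -- `ULift` moves the index set into the universe of the dual.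
  have := h (ULift ℕ) (fun n => g - f n.down) (fun m n hmn => sub_le_sub_left (hmono hmn) g)
    ⟨by rintro _ ⟨n, rfl⟩; exact sub_nonneg.2 (hfg _), fun b hb x hx => by
      have hbx : ∀ n, b x ≤ g x - f n x := fun n => hb ⟨⟨n⟩, rfl⟩ x hx
      have hz : Tendsto (fun n => g x - f n x) atTop (𝓝 0) := by
        simpa using (tendsto_const_nhds (x := g x)).sub (show Tendsto _ _ (𝓝 (g x)) from hl x)
      exact ge_of_tendsto' hz hbx⟩
  have hup : Tendsto (ULift.up : ℕ → ULift ℕ) atTop atTop :=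
    tendsto_atTop_atTop.2 fun b => ⟨b.down, fun a ha => ha⟩
  refine (this.comp hup).congr fun n => ?_
  exact norm_sub_rev _ _

variable {G : Type*} [NormedAddCommGroup G] [NormedSpace ℝ G] [Lattice G]
  [IsOrderedAddMonoid G] [IsOrderedModule ℝ G] [HasSolidNorm G]

/-- The Archimedean property: `z ≤ w / (n + 1)` for all `n`, and the order is closed. -/
theorem nonpos_of_forall_nsmul_le {z w : G} (h : ∀ n : ℕ, n • z ≤ w) : z ≤ 0 := by
  have hw : Tendsto (fun n : ℕ => (1 / ((n : ℝ) + 1)) • w) atTop (𝓝 0) := by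
    simpa using (tendsto_one_div_add_atTop_nhds_zero_nat (𝕜 := ℝ)).smul_const w
  refine ge_of_tendsto' hw fun n => ?_
  have hn : (0 : ℝ) < n + 1 := by positivity
  have h1 := smul_le_smul_of_nonneg_left (h (n + 1)) (one_div_pos.2 hn).le
  rwa [← Nat.cast_smul_eq_nsmul ℝ, smul_smul, Nat.cast_succ, one_div_mul_cancel hn.ne',
    one_smul] at h1

variable [CompleteSpace G]

/-- If the norm is order continuous, order bounded increasing sequences converge in norm. -/
theorem HasOrderContinuousNorm.exists_tendsto_of_monotone (h : HasOrderContinuousNorm G)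
    {x : ℕ → G} (hx : Monotone x) {b : G} (hb : ∀ n, x n ≤ b) :
    ∃ l, Tendsto x atTop (𝓝 l) := by
  -- No supremum of `x` is known to exist, so the net runs over all differences `y - x n` with `y`
  -- an upper bound.
  let D := {y : G // ∀ n, x n ≤ y}
  have : IsDirectedOrder Dᵒᵈ := ⟨fun p q =>
    ⟨OrderDual.toDual ⟨(OrderDual.ofDual p).1 ⊓ (OrderDual.ofDual q).1, fun n =>
      le_inf ((OrderDual.ofDual p).2 n) ((OrderDual.ofDual q).2 n)⟩,
      inf_le_left (a := (OrderDual.ofDual p).1), inf_le_right (a := (OrderDual.ofDual p).1)⟩⟩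
  have : IsDirectedOrder (Dᵒᵈ × ℕ) := ⟨fun p q =>
    let ⟨d, h1, h2⟩ := exists_ge_ge p.1 q.1
    ⟨(d, p.2 ⊔ q.2), ⟨h1, le_sup_left⟩, ⟨h2, le_sup_right⟩⟩⟩
  have : Nonempty Dᵒᵈ := ⟨OrderDual.toDual ⟨b, hb⟩⟩
  have hglb : IsGLB (Set.range fun p : Dᵒᵈ × ℕ => (OrderDual.ofDual p.1).1 - x p.2) 0 := by
    refine ⟨?_, fun c hc => ?_⟩
    · rintro _ ⟨p, rfl⟩
      exact sub_nonneg.2 ((OrderDual.ofDual p.1).2 _)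
    -- Subtracting a lower bound `c` of the net from an upper bound of `x` leaves an upper bound, so
    -- this iterates.
    · have hmem : ∀ m n : ℕ, x n ≤ b - m • c := by
        intro m
        induction m with
        | zero => simpa using hb
        | succ m ih =>
          intro n
          rw [succ_nsmul, ← sub_sub]
          exact le_sub_comm.1 (hc ⟨(OrderDual.toDual ⟨b - m • c, ih⟩, n), rfl⟩)
      exact nonpos_of_forall_nsmul_le (w := b - x 0) fun m => le_sub_comm.1 (hmem m 0)
  have hnet := h (Dᵒᵈ × ℕ) _ (fun p q hpq => sub_le_sub hpq.1 (hx hpq.2)) hglb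
  refine cauchySeq_tendsto_of_complete (Metric.cauchySeq_iff'.2 fun ε hε => ?_)
  obtain ⟨⟨y, N⟩, hy⟩ := (hnet.eventually_lt_const hε).exists
  refine ⟨N, fun n hn => ?_⟩
  rw [dist_eq_norm]
  exact (norm_le_of_mem_Icc ⟨sub_nonneg.2 (hx hn),
    sub_le_sub_right ((OrderDual.ofDual y).2 n) _⟩).trans_lt hy

/-- If the norm is order continuous, bounded disjoint positive functionals are weak* null. -/
theorem HasOrderContinuousNorm.not_forall_le_apply (h : HasOrderContinuousNorm G)
    {f : ℕ → StrongDual ℝ G} (hf0 : ∀ n, 0 ≤ f n) (hfd : DisjointSeq f) {M : ℝ}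
    (hM : ∀ n, ‖f n‖ ≤ M) {x : G} (hx : 0 ≤ x) {ε : ℝ} (hε : 0 < ε) : ¬ ∀ n, ε ≤ f n x := by
  intro hfx
  have hdisj : ∀ n, f n ⊓ ∑ k ∈ Finset.range n, f k = 0 := fun n =>
    inf_sum_eq_zero (hf0 n) hf0 _ fun k hk => by
      have := hfd n k (Finset.mem_range.1 hk).ne'
      rwa [abs_of_nonneg (hf0 n), abs_of_nonneg (hf0 k)] at this
  -- `y n` carries most of `f n x`, while all earlier functionals are tiny on it.
  choose y hy hlt using fun n => exists_mem_Icc_of_inf_eq_zero (hdisj n) hx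
    (δ := ε / 4 * (1 / 2) ^ n) (by positivity)
  have hsum0 : ∀ n, 0 ≤ (∑ k ∈ Finset.range n, f k) (y n) := fun n =>
    apply_nonneg (Finset.sum_nonneg fun k _ => hf0 k) (hy n).1
  have hdiag : ∀ n, 3 * ε / 4 ≤ f n (y n) := by
    intro n
    have h1 := hlt n
    have h2 : ε / 4 * (1 / 2) ^ n ≤ ε / 4 :=
      mul_le_of_le_one_right (by positivity) (pow_le_one₀ (by norm_num) (by norm_num))
    rw [map_sub] at h1
    linarith [hsum0 n, hfx n]
  have hoff : ∀ k n, k < n → f k (y n) ≤ ε / 4 * (1 / 2) ^ n := by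
    intro k n hkn
    have h1 : f k (y n) ≤ (∑ k ∈ Finset.range n, f k) (y n) :=
      Finset.single_le_sum (f := f) (fun i _ => hf0 i) (Finset.mem_range.2 hkn) (y n) (hy n).1
    linarith [hlt n, apply_nonneg (hf0 n) (sub_nonneg.2 (hy n).2)]
  -- The norm limits `w k` play the role of `sup {y i : i ≥ k}`. They decrease and converge in norm,
  -- yet `f k` drops by at least `3ε/4 - ε/4 = ε/2` from `w k` to `w (k + 1)`, contradicting `‖f k‖
  -- ≤ M`.
  let u : ℕ → ℕ → G := fun k => partialSups fun i => y (k + i)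
  have hule : ∀ k m, u k m ≤ x := fun k m => partialSups_le _ m x fun i _ => (hy _).2
  have humono : ∀ k, Monotone (u k) := fun k => (partialSups _).monotone
  choose w hw using fun k => h.exists_tendsto_of_monotone (humono k) (hule k)
  have huw : ∀ k m, u k m ≤ w k := fun k m => (humono k).ge_of_tendsto (hw k) m
  have hwx : ∀ k, w k ≤ x := fun k => le_of_tendsto' (hw k) (hule k)
  have hyw : ∀ k, y k ≤ w k := fun k => (huw k 0).trans' (by simp [u])
  have hwanti : Antitone w := antitone_nat_of_succ_le fun k =>
    le_of_tendsto' (hw (k + 1)) fun m => (huw k (m + 1)).trans' <|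
      partialSups_le _ m _ fun i hi => by
        rw [add_assoc, add_comm 1 i]
        exact le_partialSups_of_le (fun i => y (k + i)) (Nat.add_le_add_right hi 1)
  have hnext : ∀ k, f k (w (k + 1)) ≤ ε / 4 := by
    intro k
    refine le_of_tendsto' (((f k).continuous.tendsto _).comp (hw (k + 1))) fun m => ?_
    have h1 : u (k + 1) m ≤ ∑ i ∈ Finset.range (m + 1), y (k + 1 + i) :=
      partialSups_le _ m _ fun i hi => Finset.single_le_sum (f := fun i => y (k + 1 + i))
        (fun i _ => (hy _).1) (Finset.mem_range.2 (Nat.lt_succ_of_le hi))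
    have h2 := apply_le_apply (hf0 k) h1
    rw [map_sum] at h2
    refine h2.trans ?_
    calc ∑ i ∈ Finset.range (m + 1), f k (y (k + 1 + i))
        ≤ ∑ i ∈ Finset.range (m + 1), ε / 8 * (1 / 2) ^ i := Finset.sum_le_sum fun i _ => by
          refine (hoff k _ (by omega)).trans ?_
          rw [pow_add, pow_succ]
          have : (1 / 2 : ℝ) ^ k ≤ 1 := pow_le_one₀ (by norm_num) (by norm_num)
          have h3 : (1 / 2 : ℝ) ^ k * (1 / 2) ^ i ≤ (1 / 2) ^ i :=
            mul_le_of_le_one_left (by positivity) this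
          nlinarith
      _ ≤ ε / 8 * 2 := by
          rw [← Finset.mul_sum]
          exact mul_le_mul_of_nonneg_left (sum_geometric_two_le _) (by positivity)
      _ = ε / 4 := by ring
  -- Passing to `x - w k` turns the decreasing sequence into an increasing one bounded by `x`.
  obtain ⟨l, hl⟩ := h.exists_tendsto_of_monotone (x := fun k => x - w k) (b := x)
    (fun j k hjk => sub_le_sub_left (hwanti hjk) x)
    (fun k => sub_le_self x ((hy k).1.trans (hyw k)))
  have hlim : Tendsto (fun k => M * ‖w k - w (k + 1)‖) atTop (𝓝 0) := by
    simpa using (((hl.comp (tendsto_add_atTop_nat 1)).sub hl).norm.const_mul M)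
  obtain ⟨k, hk⟩ := (hlim.eventually_lt_const (half_pos hε)).exists
  have h1 := apply_le_mul (hM k) (le_refl ‖w k - w (k + 1)‖)
  have h2 := apply_le_apply (hf0 k) (hyw k)
  rw [map_sub] at h1
  linarith [hdiag k, hnext k]

/-- Weak* nullity enters through the uniform norm bound it provides; disjointness of the moduli does
the rest. -/
theorem HasOrderContinuousNorm.propertyD (h : HasOrderContinuousNorm G) : PropertyD G := by
  intro f hfd hf
  obtain ⟨M, hM⟩ := hf.exists_norm_le
  have hpos : ∀ x : G, 0 ≤ x → Tendsto (fun n => |f n| x) atTop (𝓝 0) := by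
    intro x hx
    refine tendsto_order.2 ⟨fun a ha => .of_forall fun n =>
      ha.trans_le (apply_nonneg (abs_nonneg _) hx), fun ε hε => ?_⟩
    by_contra hcon
    obtain ⟨φ, hφ, hφε⟩ := extraction_of_frequently_atTop (not_eventually.1 hcon)
    exact h.not_forall_le_apply (fun n => abs_nonneg (f (φ n)))
      (hfd.comp_injective hφ.injective).abs (fun n => (norm_abs_eq_norm _).trans_le (hM _)) hx hε
      fun n => not_lt.1 (hφε n)
  refine weakStarNull_iff.2 fun x => ?_
  have := (hpos _ (posPart_nonneg x)).sub (hpos _ (negPart_nonneg x))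
  rw [sub_zero] at this
  refine this.congr fun n => ?_
  rw [← map_sub, posPart_sub_negPart]

end OrderContinuous

end BanachLat

theorem mainTheorem8
    {E : Type*} [NormedAddCommGroup E] [NormedSpace ℝ E] [CompleteSpace E] [Lattice E]
    [IsOrderedAddMonoid E] [IsOrderedModule ℝ E] [HasSolidNorm E]
    {F : Type*} [NormedAddCommGroup F] [NormedSpace ℝ F] [CompleteSpace F] [Lattice F]
    [IsOrderedAddMonoid F] [IsOrderedModule ℝ F] [HasSolidNorm F] :
    (BanachLat.IsKBSpace (StrongDual ℝ E) → BanachLat.PropertyD F →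
      BanachLat.regularly (BanachLat.almostLWeaklyCompact E F) ⊆
          BanachLat.regularly (BanachLat.almostGrothendieck E F) ∧
        ∀ T ∈ BanachLat.almostLWeaklyCompact E F, BanachLat.IsPositiveOp T →
          ∀ f : ℕ → StrongDual ℝ F, BanachLat.DisjointSeq f → BanachLat.WeakStarNull f →
            Tendsto (fun n => ‖(f n).comp T‖) atTop (𝓝 0)) ∧
    (BanachLat.HasOrderContinuousNorm (StrongDual ℝ E) → BanachLat.HasOrderContinuousNorm F →
      BanachLat.regularly (BanachLat.almostLWeaklyCompact E F) ⊆
          BanachLat.regularly (BanachLat.almostGrothendieck E F) ∧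
        ∀ T ∈ BanachLat.almostLWeaklyCompact E F, BanachLat.IsPositiveOp T →
          ∀ f : ℕ → StrongDual ℝ F, BanachLat.DisjointSeq f → BanachLat.WeakStarNull f →
            Tendsto (fun n => ‖(f n).comp T‖) atTop (𝓝 0)) := by
  refine ⟨fun hE hF => ⟨BanachLat.regularly_almostLWeaklyCompact_subset hE hF,
    fun T hT hpos f hfd hf => BanachLat.norm_comp_tendsto_zero hE hF hT hpos hfd hf⟩,
    fun hE hF => ⟨BanachLat.regularly_almostLWeaklyCompact_subset hE.isKBSpace_dual hF.propertyD,
    fun T hT hpos f hfd hf =>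
      BanachLat.norm_comp_tendsto_zero hE.isKBSpace_dual hF.propertyD hT hpos hfd hf⟩⟩
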